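/- For a finite group $G$ let $\mathrm{cd}(G)$ be the set of degrees $\chi(1)$ of its complex irreducible characters and $\rho(G)$ the set of primes dividing some element of $\mathrm{cd}(G)$. The character degree graph $\Delta(G)$ is the simple graph with vertex set $\rho(G)$ in which two distinct primes $p,q$ are adjacent if and only if $pq$ divides some element of $\mathrm{cd}(G)$. A graph is a block if it is connected and has no cut vertex (a vertex whose deletion increases the number of connected components). A graph is Eulerian if it has a closed walk that traverses every edge exactly once and visits every vertex. Theorem. Let $n \ge 6$ be an even integer and let $\mathcal{G}_n$ be the class of all graphs on $n$ vertices that are isomorphic to $\Delta(G)$ for some finite solvable group $G$ and that are non-regular blocks of diameter $2$. Then the number of Eulerian graphs in $\mathcal{G}_n$, counted up to isomorphism, is at least $$\left\lfloor \frac{n-4}{2} \right\rfloor + \left( \left\lfloor \frac{n}{6} \right\rfloor - 1 \right).$$ -/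

import Mathlib

namespace CharDegree

/-- `Irr G`: the set of complex irreducible characters of `G`. -/
def Irr (G : Type) [Group G] : Set (G → ℂ) :=
  {χ | ∃ (V : Type) (_ : AddCommGroup V) (_ : Module ℂ V) (_ : FiniteDimensional ℂ V)
    (σ : Representation ℂ G V), σ.IsIrreducible ∧ σ.character = χ}

/-- `cd G`: the set of degrees `χ 1` of the complex irreducible characters of `G`. -/
def cd (G : Type) [Group G] : Set ℕ :=
  {d | ∃ χ ∈ Irr G, χ 1 = (d : ℂ)}

/-- `rho G`: the set of primes dividing some irreducible character degree of `G`. -/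
def rho (G : Type) [Group G] : Set ℕ :=
  {p | p.Prime ∧ ∃ d ∈ cd G, p ∣ d}

/-- The character degree graph of `G`: its vertex set is `rho G`, and two distinct primes
`p`, `q` are adjacent when `p * q` divides some irreducible character degree of `G`. -/
def degreeGraph (G : Type) [Group G] : SimpleGraph (rho G) where
  Adj p q := p ≠ q ∧ ∃ d ∈ cd G, (p : ℕ) * (q : ℕ) ∣ d
  symm := ⟨fun p q h => ⟨h.1.symm, by simpa only [mul_comm] using h.2⟩⟩
  loopless := ⟨fun _ h => h.1 rfl⟩

/-- `Γ` is, up to isomorphism, the character degree graph of a finite solvable group. -/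
def IsSolvableDegreeGraph {V : Type} (Γ : SimpleGraph V) : Prop :=
  ∃ (G : Type) (_ : Group G), Finite G ∧ Group.IsSolvable G ∧ Nonempty (Γ ≃g degreeGraph G)

/-- `v` is a cut vertex: deleting it increases the number of connected components. -/
def IsCutVertex {V : Type} (Γ : SimpleGraph V) (v : V) : Prop :=
  Nat.card Γ.ConnectedComponent < Nat.card (Γ.induce {v}ᶜ).ConnectedComponent

/-- A graph that is a block: it is connected and has no cut vertex. -/
def IsBlock {V : Type} (Γ : SimpleGraph V) : Prop :=
  Γ.Connected ∧ ∀ v, ¬ IsCutVertex Γ v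

open Classical in
/-- All vertices have the same degree. -/
def IsRegular {V : Type} [Fintype V] (Γ : SimpleGraph V) : Prop :=
  ∃ k, Γ.IsRegularOfDegree k

open Classical in
/-- `Γ` has a closed walk that uses every edge exactly once and visits every vertex. -/
def IsEulerian {V : Type} (Γ : SimpleGraph V) : Prop :=
  ∃ (v : V) (w : Γ.Walk v v), w.IsEulerian ∧ ∀ u, u ∈ w.support

/-- The graphs on `n` vertices that are character degree graphs of finite solvable groups and
are non-regular blocks of diameter `2`. -/
def classG (n : ℕ) : Set (SimpleGraph (Fin n)) :=
  {Γ | IsSolvableDegreeGraph Γ ∧ ¬ IsRegular Γ ∧ IsBlock Γ ∧ Γ.ediam = 2}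

/-- Isomorphism of graphs with vertex set `Fin n`. -/
def isoSetoid (n : ℕ) : Setoid (SimpleGraph (Fin n)) where
  r Γ Γ' := Nonempty (Γ ≃g Γ')
  iseqv :=
    { refl := fun _ => ⟨SimpleGraph.Iso.refl⟩
      symm := fun ⟨e⟩ => ⟨e.symm⟩
      trans := fun ⟨e⟩ ⟨f⟩ => ⟨e.trans f⟩ }

/-- The number of isomorphism classes of graphs belonging to the set `S`. -/
noncomputable def numIsoClasses {n : ℕ} (S : Set (SimpleGraph (Fin n))) : ℕ :=
  ((Quotient.mk (isoSetoid n)) '' S).ncard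

end CharDegree

/-! Complements of forests of stars are character degree graphs of solvable groups, and parity makes
enough of them Eulerian.

For a prime `p` and a subgroup `K` of `(ZMod p)ˣ`, the solvable group `HeisExt K` has degree set
`{1, p, |K|}` (`HeisExt.cd_eq`): the unipotent part is a Heisenberg group, on whose centre `K` acts
trivially. Degrees multiply over direct products (`mem_cd_prod_iff`). Take a product of such groups
with all `p i` and all prime factors of all `|K i|` distinct, each `|K i|` being squarefree. Two
primes then fail to be adjacent exactly when one is some `p i` and the other divides the same `|K
i|`. The complement of the degree graph is thus a disjoint union of stars with prescribed numbers of
leaves (`isSolvableDegreeGraph_compl_starForest`).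

If there are at least two stars, all with an odd number of leaves and one with more than one, the
complement has even order and only even degrees, is not regular, and any two nonadjacent vertices
have two common neighbours. So it is an Eulerian non-regular block of diameter 2
(`mem_classG_and_isEulerian`). Leaf numbers `2a+1, 2b+1, 1, ..., 1` with `b ≤ a` are recovered from
degree sums (`params_eq_of_iso`); the families `b = 0` and `b = a` give the two terms of the bound.
-/

namespace CharDegree

open Module

/-! ### Stable subspaces and irreducibility of complex representations -/

section Rep

variable {G V : Type*} [Group G] [AddCommGroup V] [Module ℂ V]

/-- `W` is stable under the action of `G`. -/
def IsStable (ρ : Representation ℂ G V) (W : Submodule ℂ V) : Prop :=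
  ∀ g, ∀ w ∈ W, ρ g w ∈ W

theorem IsStable.inf {ρ : Representation ℂ G V} {W W' : Submodule ℂ V} (h : IsStable ρ W)
    (h' : IsStable ρ W') : IsStable ρ (W ⊓ W') :=
  fun g w hw => ⟨h g w hw.1, h' g w hw.2⟩

theorem isIrreducible_iff (ρ : Representation ℂ G V) :
    ρ.IsIrreducible ↔ Nontrivial V ∧ ∀ W, IsStable ρ W → W = ⊥ ∨ W = ⊤ := by
  constructor
  · intro h
    refine ⟨?_, fun W hW => ?_⟩
    · by_contra hV
      rw [not_nontrivial_iff_subsingleton] at hV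
      exact h.toNontrivial.exists_pair_ne.elim fun a ⟨b, hab⟩ => hab (by
        ext x; simp [Subsingleton.elim x 0, zero_mem])
    · rcases h.eq_bot_or_eq_top (⟨W, hW⟩ : Subrepresentation ρ) with h | h
      · exact Or.inl (congrArg Subrepresentation.toSubmodule h)
      · exact Or.inr (congrArg Subrepresentation.toSubmodule h)
  · rintro ⟨hV, h⟩
    refine { exists_pair_ne := ⟨⊥, ⊤, fun e => ?_⟩, eq_bot_or_eq_top := fun W => ?_ }
    · exact bot_ne_top (congrArg Subrepresentation.toSubmodule e :
        (⊥ : Submodule ℂ V) = ⊤)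
    · exact (h W.toSubmodule W.apply_mem_toSubmodule).imp
        (fun e => Subrepresentation.toSubmodule_injective e)
        (fun e => Subrepresentation.toSubmodule_injective e)

theorem exists_minimal_stable [FiniteDimensional ℂ V] {ρ : Representation ℂ G V}
    (φ : Submodule ℂ V → Prop) (h : ∃ W, IsStable ρ W ∧ φ W) :
    ∃ W, IsStable ρ W ∧ φ W ∧ ∀ W' ≤ W, IsStable ρ W' → φ W' → W' = W := by
  obtain ⟨W, hW, hmin⟩ := (wellFounded_lt (α := Submodule ℂ V)).has_min
    {W | IsStable ρ W ∧ φ W} h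
  refine ⟨W, hW.1, hW.2, fun W' hle hs hφ => ?_⟩
  by_contra hne
  exact hmin W' ⟨hs, hφ⟩ (lt_of_le_of_ne hle hne)

theorem isIrreducible_toRepresentation {ρ : Representation ℂ G V} (Q : Subrepresentation ρ)
    (h0 : Q.toSubmodule ≠ ⊥)
    (h : ∀ W ≤ Q.toSubmodule, IsStable ρ W → W ≠ ⊥ → W = Q.toSubmodule) :
    Q.toRepresentation.IsIrreducible := by
  rw [isIrreducible_iff]
  refine ⟨Submodule.nontrivial_iff_ne_bot.2 h0, fun W hW => ?_⟩
  by_cases hb : W = ⊥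
  · exact Or.inl hb
  right
  have h1 := h (W.map Q.toSubmodule.subtype) (Submodule.map_subtype_le _ _) ?_ ?_
  · rw [eq_top_iff]
    rintro x -
    have hx : (x : V) ∈ W.map Q.toSubmodule.subtype := by rw [h1]; exact x.2
    obtain ⟨y, hy, hxy⟩ := hx
    rwa [← Subtype.ext hxy]
  · rintro g _ ⟨y, hy, rfl⟩
    exact ⟨_, hW g y hy, rfl⟩
  · intro e
    exact hb (Submodule.map_injective_of_injective (Submodule.injective_subtype _)
      (e.trans (Submodule.map_bot _).symm))

theorem exists_irreducible_le [FiniteDimensional ℂ V] {ρ : Representation ℂ G V}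
    {W : Submodule ℂ V} (hW : IsStable ρ W) (h0 : W ≠ ⊥) :
    ∃ Q : Subrepresentation ρ, Q.toSubmodule ≤ W ∧ Q.toRepresentation.IsIrreducible := by
  obtain ⟨U, hU, hφ, hmin⟩ := exists_minimal_stable (ρ := ρ)
    (fun U => U ≤ W ∧ U ≠ ⊥) ⟨W, hW, le_rfl, h0⟩
  exact ⟨⟨U, hU⟩, hφ.1, isIrreducible_toRepresentation _ hφ.2
    fun W' hle hs hne => hmin W' hle hs ⟨hle.trans hφ.1, hne⟩⟩

theorem exists_stable_isCompl [Finite G] {ρ : Representation ℂ G V} {W : Submodule ℂ V}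
    (hW : IsStable ρ W) : ∃ W', IsStable ρ W' ∧ IsCompl W W' := by
  have : NeZero (Nat.card G : ℂ) := ⟨by exact_mod_cast Nat.card_pos.ne'⟩
  obtain ⟨Q, hQ⟩ := exists_isCompl (⟨W, hW⟩ : Subrepresentation ρ)
  refine ⟨Q.toSubmodule, Q.apply_mem_toSubmodule, ?_, ?_⟩
  · rw [disjoint_iff]
    exact congrArg Subrepresentation.toSubmodule hQ.inf_eq_bot
  · rw [codisjoint_iff]
    exact congrArg Subrepresentation.toSubmodule hQ.sup_eq_top

/-- Take a minimal stable `U` on which `g` moves some vector. If `U` had a proper nonzero stable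
subspace, Maschke would split `U` into two smaller stable pieces, both fixed pointwise by `g`, a
contradiction. This serves to show that a given degree occurs. -/
theorem exists_irreducible_apply_ne_one [Finite G] [FiniteDimensional ℂ V]
    (ρ : Representation ℂ G V) {g : G} (hg : ρ g ≠ 1) :
    ∃ Q : Subrepresentation ρ, Q.toRepresentation.IsIrreducible ∧ Q.toRepresentation g ≠ 1 := by
  obtain ⟨U, hU, ⟨u, hu, hgu⟩, hmin⟩ := exists_minimal_stable (ρ := ρ)
    (fun U => ∃ u ∈ U, ρ g u ≠ u) ⟨⊤, fun _ _ _ => trivial, by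
      by_contra! h
      exact hg (LinearMap.ext fun v => h v trivial)⟩
  refine ⟨⟨U, hU⟩, isIrreducible_toRepresentation _ ?_ ?_, ?_⟩
  · rintro rfl
    rw [Submodule.mem_bot] at hu
    simp [hu] at hgu
  · intro W hle hs hne
    by_contra hneq
    change W ≤ U at hle
    change ¬ W = U at hneq
    obtain ⟨W', hs', hc⟩ := exists_stable_isCompl hs
    have h1 : ∀ w ∈ W, ρ g w = w := by
      by_contra! h
      exact hneq (hmin W hle hs h)
    have h2 : ∀ w ∈ U ⊓ W', ρ g w = w := by
      by_contra! h
      have := hmin (U ⊓ W') inf_le_left (hU.inf hs') h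
      have h3 : W ≤ W' := hle.trans (inf_eq_left.1 this)
      exact hne (hc.disjoint.eq_bot_of_le h3)
    obtain ⟨a, ha, b, hb, rfl⟩ := Submodule.mem_sup.1
      (hc.sup_eq_top ▸ Submodule.mem_top : u ∈ W ⊔ W')
    apply hgu
    rw [map_add, h1 a ha, h2 b ⟨(Submodule.add_mem_iff_right _ (hle ha)).1 hu, hb⟩]
  · intro e
    have := congrArg Subtype.val (LinearMap.congr_fun e ⟨u, hu⟩)
    exact hgu this

/-- A stable line inside a nonzero stable subspace on which the operators commute. -/
theorem exists_common_eigenvector [FiniteDimensional ℂ V] {ρ : Representation ℂ G V}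
    (hcomm : ∀ g h v, ρ g (ρ h v) = ρ h (ρ g v)) {W : Submodule ℂ V} (hW : IsStable ρ W)
    (h0 : W ≠ ⊥) : ∃ v ∈ W, v ≠ 0 ∧ ∀ g, ∃ c : ℂ, ρ g v = c • v := by
  obtain ⟨Q, hQW, hQ⟩ := exists_irreducible_le hW h0
  have hnt : Nontrivial Q.toSubmodule := ((isIrreducible_iff _).1 hQ).1
  obtain ⟨v, hv⟩ := exists_ne (0 : Q.toSubmodule)
  refine ⟨v, hQW v.2, by simpa using hv, fun g => ?_⟩
  obtain ⟨c, hc⟩ := End.exists_eigenvalue (Q.toRepresentation g)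
  refine ⟨c, ?_⟩
  have hst : IsStable Q.toRepresentation (End.eigenspace (Q.toRepresentation g) c) := by
    intro h w hw
    rw [End.mem_eigenspace_iff] at hw ⊢
    have : Q.toRepresentation g (Q.toRepresentation h w)
        = Q.toRepresentation h (Q.toRepresentation g w) := Subtype.ext (hcomm g h w)
    rw [this, hw, map_smul]
  rcases ((isIrreducible_iff _).1 hQ).2 _ hst with h | h
  · exact absurd h hc
  · have : v ∈ End.eigenspace (Q.toRepresentation g) c := h ▸ Submodule.mem_top
    exact congrArg Subtype.val (End.mem_eigenspace_iff.1 this)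

theorem exists_scalar_of_central [FiniteDimensional ℂ V] {ρ : Representation ℂ G V}
    (hρ : ρ.IsIrreducible) {z : G} (hz : ∀ g, g * z = z * g) : ∃ c : ℂ, ∀ v, ρ z v = c • v := by
  have hnt : Nontrivial V := ((isIrreducible_iff _).1 hρ).1
  obtain ⟨c, hc⟩ := End.exists_eigenvalue (ρ z)
  refine ⟨c, fun v => ?_⟩
  have hst : IsStable ρ (End.eigenspace (ρ z) c) := by
    intro g w hw
    rw [End.mem_eigenspace_iff] at hw ⊢
    rw [← Module.End.mul_apply, ← map_mul, ← hz, map_mul, Module.End.mul_apply, hw, map_smul]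
  rcases ((isIrreducible_iff _).1 hρ).2 _ hst with h | h
  · exact absurd h hc
  · exact End.mem_eigenspace_iff.1 (h ▸ Submodule.mem_top)

/-- An irreducible representation spanned by eigenvectors of one element with distinct
eigenvalues. -/
theorem finrank_eq_card_of_monomial {ρ : Representation ℂ G V}
    (hρ : ρ.IsIrreducible) {ι : Type*} [Fintype ι] [Nonempty ι] (w : ι → V) (T : G) (c : ι → ℂ)
    (hc : Function.Injective c) (h0 : ∀ i, w i ≠ 0) (hT : ∀ i, ρ T (w i) = c i • w i)
    (hst : ∀ g i, ∃ j, ∃ a : ℂ, ρ g (w i) = a • w j) : finrank ℂ V = Fintype.card ι := by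
  have hli : LinearIndependent ℂ w := End.eigenvectors_linearIndependent' (ρ T) c hc w
    fun i => ⟨End.mem_eigenspace_iff.2 (hT i), h0 i⟩
  have hspan : Submodule.span ℂ (Set.range w) = ⊤ := by
    refine (((isIrreducible_iff _).1 hρ).2 _ ?_).resolve_left ?_
    · intro g v hv
      induction hv using Submodule.span_induction with
      | mem x hx =>
        obtain ⟨i, rfl⟩ := hx
        obtain ⟨j, a, e⟩ := hst g i
        rw [e]
        exact Submodule.smul_mem _ _ (Submodule.subset_span ⟨j, rfl⟩)
      | zero => simp
      | add x y _ _ hx hy => rw [map_add]; exact add_mem hx hy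
      | smul a x _ hx => rw [map_smul]; exact Submodule.smul_mem _ _ hx
    · intro h
      rw [Submodule.span_eq_bot] at h
      exact h0 (Classical.arbitrary ι) (h _ ⟨_, rfl⟩)
  exact finrank_eq_card_basis (Basis.mk hli hspan.ge)

/-- Converse of Schur's lemma: the projection onto a stable subspace along a stable complement
intertwines, hence is a scalar, which must be 1 if the subspace is nonzero. -/
theorem isIrreducible_of_finrank_intertwiningMap [Finite G] [Nontrivial V]
    {ρ : Representation ℂ G V} (h : finrank ℂ (Representation.IntertwiningMap ρ ρ) = 1) :
    ρ.IsIrreducible := by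
  rw [isIrreducible_iff]
  refine ⟨inferInstance, fun W hW => ?_⟩
  obtain ⟨W', hW', hc⟩ := exists_stable_isCompl hW
  have hP : ∀ g v, W.projection W' hc (ρ g v) = ρ g (W.projection W' hc v) := by
    intro g v
    obtain ⟨a, ha, b, hb, rfl⟩ := Submodule.mem_sup.1
      (hc.sup_eq_top ▸ Submodule.mem_top : v ∈ W ⊔ W')
    simp only [map_add]
    rw [Submodule.projection_apply_of_mem_left hc ha,
      Submodule.projection_apply_of_mem_left hc (hW g a ha),
      Submodule.projection_apply_of_mem_right hc hb,
      Submodule.projection_apply_of_mem_right hc (hW' g b hb), map_zero]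
  have hid : Representation.IntertwiningMap.id ρ ≠ 0 := by
    intro e
    obtain ⟨v, hv⟩ := exists_ne (0 : V)
    exact hv (DFunLike.congr_fun e v)
  obtain ⟨c, hcid⟩ := (finrank_eq_one_iff_of_nonzero' _ hid).1 h
    ((W.projection W' hc).intertwiningMap_of_isIntertwiningMap ρ ρ hP)
  have hpr : ∀ v, c • v = W.projection W' hc v := fun v => DFunLike.congr_fun hcid v
  by_cases hb : W = ⊥
  · exact Or.inl hb
  right
  obtain ⟨w, hw, hw0⟩ := Submodule.exists_mem_ne_zero_of_ne_bot hb
  have hc1 : c = 1 := by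
    have := hpr w
    rw [Submodule.projection_apply_of_mem_left hc hw] at this
    exact smul_left_injective ℂ hw0 (by simpa using this)
  rw [eq_top_iff]
  rintro v -
  have := hpr v
  rw [hc1, one_smul] at this
  rw [this]
  exact Submodule.projection_apply_mem hc v

end Rep

theorem mem_cd_iff {G : Type} [Group G] {d : ℕ} : d ∈ cd G ↔
    ∃ (V : Type) (_ : AddCommGroup V) (_ : Module ℂ V) (_ : FiniteDimensional ℂ V)
      (ρ : Representation ℂ G V), ρ.IsIrreducible ∧ finrank ℂ V = d := by
  constructor
  · rintro ⟨_, ⟨V, _, _, _, ρ, hρ, rfl⟩, h⟩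
    refine ⟨V, _, _, ‹_›, ρ, hρ, ?_⟩
    rw [Representation.char_one] at h
    exact_mod_cast h
  · rintro ⟨V, _, _, _, ρ, hρ, rfl⟩
    exact ⟨_, ⟨V, _, _, ‹_›, ρ, hρ, rfl⟩, Representation.char_one ρ⟩

/-! ### Character degrees of direct products -/

section Prod

variable {A B : Type*} [Group A] [Group B]
  {V W : Type*} [AddCommGroup V] [Module ℂ V] [AddCommGroup W] [Module ℂ W]

/-- The external tensor product of two representations. -/
noncomputable def extTensor (ρ : Representation ℂ A V) (σ : Representation ℂ B W) :
    Representation ℂ (A × B) (TensorProduct ℂ V W) :=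
  Representation.tprod (ρ.comp (MonoidHom.fst A B)) (σ.comp (MonoidHom.snd A B))

/-- The character of the external tensor product is a product, so its norm factors as the product of
the two norms, both equal to 1. -/
theorem isIrreducible_extTensor [Finite A] [Finite B] [FiniteDimensional ℂ V]
    [FiniteDimensional ℂ W] {ρ : Representation ℂ A V} {σ : Representation ℂ B W}
    (hρ : ρ.IsIrreducible) (hσ : σ.IsIrreducible) : (extTensor ρ σ).IsIrreducible := by
  classical
  have := Fintype.ofFinite A
  have := Fintype.ofFinite B
  have : Nontrivial V := ((isIrreducible_iff _).1 hρ).1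
  have : Nontrivial W := ((isIrreducible_iff _).1 hσ).1
  have : Nontrivial (TensorProduct ℂ V W) := by
    apply Module.nontrivial_of_finrank_pos (R := ℂ)
    rw [finrank_tensorProduct]
    exact Nat.mul_pos finrank_pos finrank_pos
  have cA : (Nat.card A : ℂ) ≠ 0 := by exact_mod_cast Nat.card_pos.ne'
  have cB : (Nat.card B : ℂ) ≠ 0 := by exact_mod_cast Nat.card_pos.ne'
  have cAB : (Nat.card (A × B) : ℂ) ≠ 0 := by exact_mod_cast Nat.card_pos.ne'
  let := invertibleOfNonzero cA
  let := invertibleOfNonzero cB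
  let := invertibleOfNonzero cAB
  apply isIrreducible_of_finrank_intertwiningMap
  have h1 := Representation.card_inv_mul_sum_char_mul_char_eq_finrank ρ ρ
  have h2 := Representation.card_inv_mul_sum_char_mul_char_eq_finrank σ σ
  have h3 := Representation.card_inv_mul_sum_char_mul_char_eq_finrank
    (extTensor ρ σ) (extTensor ρ σ)
  rw [Representation.IsIrreducible.finrank_intertwiningMap_self, Nat.cast_one] at h1 h2
  have hch : ∀ a b, (extTensor ρ σ).character (a, b) = ρ.character a * σ.character b :=
    fun a b => by
      rw [extTensor, Representation.char_tensor]
      rfl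
  have : ((finrank ℂ (Representation.IntertwiningMap (extTensor ρ σ) (extTensor ρ σ)) : ℕ) : ℂ)
      = 1 := by
    rw [← h3, Fintype.sum_prod_type]
    simp only [Prod.inv_mk, hch, Nat.card_prod, Nat.cast_mul, mul_inv]
    rw [← mul_one (1 : ℂ)]
    nth_rewrite 1 [← h1]
    rw [← h2]
    rw [mul_mul_mul_comm, Finset.sum_mul_sum]
    congr 1
    exact Finset.sum_congr rfl fun a _ => Finset.sum_congr rfl fun b _ => by ring
  exact_mod_cast this

/-- Post-composition of linear maps with a representation. -/
def postcomp (ρ : Representation ℂ B V) : Representation ℂ B (W →ₗ[ℂ] V) where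
  toFun b := LinearMap.compRight ℂ (ρ b)
  map_one' := by ext; simp
  map_mul' a b := by ext; simp

/-- Choose an `A`-irreducible `Q` in `V`. The multiplicity space `Hom_A(Q, V)` carries an action of
`B`; let `U` be an irreducible part of it. Evaluation `Q ⊗ U → V` is a nonzero intertwining map
between irreducibles, hence bijective. -/
theorem finrank_irreducible_prod [Finite A] [Finite B] [FiniteDimensional ℂ V]
    {ρ : Representation ℂ (A × B) V} (hρ : ρ.IsIrreducible) :
    ∃ (Q : Submodule ℂ V) (σ : Representation ℂ A Q) (U : Submodule ℂ (Q →ₗ[ℂ] V))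
      (τ : Representation ℂ B U), σ.IsIrreducible ∧ τ.IsIrreducible ∧
      finrank ℂ V = finrank ℂ Q * finrank ℂ U := by
  have hnt : Nontrivial V := ((isIrreducible_iff _).1 hρ).1
  obtain ⟨Q, -, hQ⟩ := exists_irreducible_le (ρ := ρ.comp (MonoidHom.inl A B)) (W := ⊤)
    (fun _ _ _ => trivial) top_ne_bot
  have hntQ : Nontrivial Q.toSubmodule := ((isIrreducible_iff _).1 hQ).1
  let U₀ : Submodule ℂ (Q.toSubmodule →ₗ[ℂ] V) :=
    { carrier := {f | ∀ a w, f (Q.toRepresentation a w) = ρ (a, 1) (f w)}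
      add_mem' := fun hf hg a w => by simp [hf a w, hg a w]
      zero_mem' := fun a w => by simp
      smul_mem' := fun c f hf a w => by simp [hf a w] }
  have hst : IsStable (postcomp (W := Q.toSubmodule) (ρ.comp (MonoidHom.inr A B))) U₀ := by
    intro b f hf a w
    change ρ (1, b) (f (Q.toRepresentation a w)) = ρ (a, 1) (ρ (1, b) (f w))
    rw [hf, ← Module.End.mul_apply, ← Module.End.mul_apply, ← map_mul, ← map_mul]
    simp
  have hne : U₀ ≠ ⊥ := by
    intro h
    have hmem : Q.toSubmodule.subtype ∈ U₀ := fun a w => rfl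
    rw [h, Submodule.mem_bot] at hmem
    obtain ⟨v, hv⟩ := exists_ne (0 : Q.toSubmodule)
    exact hv (Subtype.ext (LinearMap.congr_fun hmem v))
  obtain ⟨U, hU, hirr⟩ := exists_irreducible_le hst hne
  refine ⟨Q.toSubmodule, Q.toRepresentation, U.toSubmodule, U.toRepresentation, hQ, hirr, ?_⟩
  let ev : TensorProduct ℂ Q.toSubmodule U.toSubmodule →ₗ[ℂ] V :=
    TensorProduct.lift U.toSubmodule.subtype.flip
  have hev : ∀ g x, ev (extTensor Q.toRepresentation U.toRepresentation g x) = ρ g (ev x) := by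
    rintro ⟨a, b⟩ x
    induction x using TensorProduct.induction_on with
    | zero => simp
    | add x y hx hy => simp [hx, hy]
    | tmul w f =>
      change ρ (1, b) ((f : Q.toSubmodule →ₗ[ℂ] V) (Q.toRepresentation a w))
        = ρ (a, b) ((f : Q.toSubmodule →ₗ[ℂ] V) w)
      rw [hU f.2, ← Module.End.mul_apply, ← map_mul]
      simp
  have hten := isIrreducible_extTensor hQ hirr
  rcases Representation.IsIrreducible.bijective_or_eq_zero
    (ev.intertwiningMap_of_isIntertwiningMap _ _ hev) with h | h
  · rw [← finrank_tensorProduct]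
    exact (LinearEquiv.ofBijective ev h).finrank_eq.symm
  · exfalso
    have hntU : Nontrivial U.toSubmodule := ((isIrreducible_iff _).1 hirr).1
    obtain ⟨f, hf⟩ := exists_ne (0 : U.toSubmodule)
    exact hf (Subtype.ext (LinearMap.ext fun w => DFunLike.congr_fun h (w ⊗ₜ[ℂ] f)))

theorem mem_cd_prod_iff {A B : Type} [Group A] [Group B] [Finite A] [Finite B] {d : ℕ} :
    d ∈ cd (A × B) ↔ ∃ a ∈ cd A, ∃ b ∈ cd B, d = a * b := by
  simp only [mem_cd_iff]
  constructor
  · rintro ⟨V, _, _, _, ρ, hρ, rfl⟩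
    obtain ⟨Q, σ, U, τ, hσ, hτ, h⟩ := finrank_irreducible_prod hρ
    exact ⟨_, ⟨Q, _, _, inferInstance, σ, hσ, rfl⟩, _, ⟨U, _, _, inferInstance, τ, hτ, rfl⟩, h⟩
  · rintro ⟨_, ⟨V, _, _, _, ρ, hρ, rfl⟩, _, ⟨W, _, _, _, σ, hσ, rfl⟩, rfl⟩
    exact ⟨_, _, _, inferInstance, _, isIrreducible_extTensor hρ hσ, finrank_tensorProduct⟩

end Prod

end CharDegree

/-! ### The Heisenberg group extended by a group of diagonal matrices -/

namespace CharDegree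

open Module

/-- The group of matrices `!![1, x, z; 0, b, y; 0, 0, 1]` over `ZMod p` with `b` in `K`. -/
@[ext]
structure HeisExt {p : ℕ} (K : Subgroup (ZMod p)ˣ) where
  /-- The central diagonal entry. -/
  b : K
  /-- The entry `(1, 2)`. -/
  x : ZMod p
  /-- The entry `(2, 3)`. -/
  y : ZMod p
  /-- The entry `(1, 3)`. -/
  z : ZMod p

theorem one_mem_cd (G : Type) [Group G] : 1 ∈ cd G := by
  rw [mem_cd_iff]
  refine ⟨ℂ, _, _, inferInstance, 1, (isIrreducible_iff _).2 ⟨inferInstance, fun W _ => ?_⟩,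
    finrank_self ℂ⟩
  exact eq_bot_or_eq_top W

theorem ofMulAction_ne_one {G X : Type*} [Group G] [MulAction G X] {g : G} {x : X}
    (h : g • x ≠ x) : Representation.ofMulAction ℂ G X g ≠ 1 := by
  intro e
  have h1 := LinearMap.congr_fun e (MonoidAlgebra.single x 1)
  rw [Representation.ofMulAction_single, Module.End.one_apply] at h1
  simp [← MonoidAlgebra.coeff_inj, Finsupp.single_eq_single_iff, h] at h1

theorem ofMulAction_eq_one {G X : Type*} [Group G] [MulAction G X] {g : G}
    (h : ∀ x : X, g • x = x) : Representation.ofMulAction ℂ G X g = 1 := by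
  ext x
  simp [h]

namespace HeisExt

section Basic

variable {p : ℕ} {K : Subgroup (ZMod p)ˣ}

instance : Mul (HeisExt K) where
  mul g h := ⟨g.b * h.b, h.x + g.x * ((h.b : (ZMod p)ˣ) : ZMod p),
    ((g.b : (ZMod p)ˣ) : ZMod p) * h.y + g.y, h.z + g.z + g.x * h.y⟩

instance : One (HeisExt K) where
  one := ⟨1, 0, 0, 0⟩

instance : Inv (HeisExt K) where
  inv g := ⟨g.b⁻¹, -(g.x * (((g.b)⁻¹ : K) : (ZMod p)ˣ)), -((((g.b)⁻¹ : K) : (ZMod p)ˣ) * g.y),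
    -g.z + g.x * (((g.b)⁻¹ : K) : (ZMod p)ˣ) * g.y⟩

@[simp] theorem mul_b (g h : HeisExt K) : (g * h).b = g.b * h.b := rfl
@[simp] theorem mul_x (g h : HeisExt K) :
    (g * h).x = h.x + g.x * ((h.b : (ZMod p)ˣ) : ZMod p) := rfl
@[simp] theorem mul_y (g h : HeisExt K) :
    (g * h).y = ((g.b : (ZMod p)ˣ) : ZMod p) * h.y + g.y := rfl
@[simp] theorem mul_z (g h : HeisExt K) : (g * h).z = h.z + g.z + g.x * h.y := rfl
@[simp] theorem one_b : (1 : HeisExt K).b = 1 := rfl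
@[simp] theorem one_x : (1 : HeisExt K).x = 0 := rfl
@[simp] theorem one_y : (1 : HeisExt K).y = 0 := rfl
@[simp] theorem one_z : (1 : HeisExt K).z = 0 := rfl
@[simp] theorem inv_b (g : HeisExt K) : g⁻¹.b = g.b⁻¹ := rfl
@[simp] theorem inv_x (g : HeisExt K) :
    g⁻¹.x = -(g.x * (((g.b)⁻¹ : K) : (ZMod p)ˣ)) := rfl
@[simp] theorem inv_y (g : HeisExt K) :
    g⁻¹.y = -((((g.b)⁻¹ : K) : (ZMod p)ˣ) * g.y) := rfl
@[simp] theorem inv_z (g : HeisExt K) :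
    g⁻¹.z = -g.z + g.x * (((g.b)⁻¹ : K) : (ZMod p)ˣ) * g.y := rfl

instance : Group (HeisExt K) :=
  Group.ofLeftAxioms
    (fun g h k => by ext <;> simp <;> ring)
    (fun g => by ext <;> simp)
    (fun g => by ext <;> simp [mul_assoc])

instance [NeZero p] : Finite (HeisExt K) :=
  Finite.of_injective (fun g : HeisExt K => (g.b, g.x, g.y, g.z)) fun g h e => by
    simp only [Prod.mk.injEq] at e
    exact HeisExt.ext e.1 e.2.1 e.2.2.1 e.2.2.2

/-- The subgroup of unitriangular matrices. -/
def unip (K : Subgroup (ZMod p)ˣ) : Subgroup (HeisExt K) where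
  carrier := {g | g.b = 1}
  mul_mem' := fun {g h} hg hh => by
    simp only [Set.mem_ofPred_eq] at hg hh
    simp [hg, hh]
  one_mem' := rfl
  inv_mem' := fun {g} hg => by
    simp only [Set.mem_ofPred_eq] at hg
    simp [hg]

/-- The subgroup of matrices differing from the identity only in the corner. -/
def corner (K : Subgroup (ZMod p)ˣ) : Subgroup (HeisExt K) where
  carrier := {g | g.b = 1 ∧ g.x = 0 ∧ g.y = 0}
  mul_mem' := fun {g h} hg hh => by
    simp only [Set.mem_ofPred_eq] at hg hh
    simp [hg, hh]
  one_mem' := ⟨rfl, rfl, rfl⟩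
  inv_mem' := fun {g} hg => by
    simp only [Set.mem_ofPred_eq] at hg
    simp [hg]

theorem mem_unip {g : HeisExt K} : g ∈ unip K ↔ g.b = 1 := Iff.rfl

theorem mem_corner {g : HeisExt K} : g ∈ corner K ↔ g.b = 1 ∧ g.x = 0 ∧ g.y = 0 := Iff.rfl

/-- The derived series descends through `unip K` and `corner K`, since the successive quotients and
`corner K` itself are abelian. -/
instance : Group.IsSolvable (HeisExt K) := by
  have h1 : ⁅(⊤ : Subgroup (HeisExt K)), ⊤⁆ ≤ unip K := by
    rw [Subgroup.commutator_le]
    intro g _ h _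
    simp [mem_unip, commutatorElement_def]
  have h2 : ⁅unip K, unip K⁆ ≤ corner K := by
    rw [Subgroup.commutator_le]
    intro g hg h hh
    rw [mem_unip] at hg hh
    simp [mem_corner, commutatorElement_def, hg, hh]
  have h3 : ⁅corner K, corner K⁆ ≤ ⊥ := by
    rw [Subgroup.commutator_le]
    intro g hg h hh
    rw [mem_corner] at hg hh
    rw [Subgroup.mem_bot]
    ext <;> simp [commutatorElement_def, hg, hh]
  refine ⟨3, ?_⟩
  rw [eq_bot_iff]
  exact (Subgroup.commutator_mono ((Subgroup.commutator_mono h1 h1).trans h2)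
    ((Subgroup.commutator_mono h1 h1).trans h2)).trans h3

/-- The diagonal matrix with entries `1, k, 1`. -/
def diag (k : K) : HeisExt K := ⟨k, 0, 0, 0⟩

variable (K) in
/-- The elementary matrix with entry `(1, 2)` equal to `t`. -/
def ex (t : ZMod p) : HeisExt K := ⟨1, t, 0, 0⟩

variable (K) in
/-- The elementary matrix with entry `(2, 3)` equal to `t`. -/
def ey (t : ZMod p) : HeisExt K := ⟨1, 0, t, 0⟩

variable (K) in
/-- The elementary matrix with entry `(1, 3)` equal to `t`. -/
def ez (t : ZMod p) : HeisExt K := ⟨1, 0, 0, t⟩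

theorem ex_pow (t : ZMod p) (n : ℕ) : ex K t ^ n = ex K (n * t) := by
  induction n with
  | zero => ext <;> simp [ex]
  | succ n ih => rw [pow_succ, ih]; ext <;> simp [ex]; ring

theorem ey_pow (t : ZMod p) (n : ℕ) : ey K t ^ n = ey K (n * t) := by
  induction n with
  | zero => ext <;> simp [ey]
  | succ n ih => rw [pow_succ, ih]; ext <;> simp [ey]; ring

theorem ez_pow (t : ZMod p) (n : ℕ) : ez K t ^ n = ez K (n * t) := by
  induction n with
  | zero => ext <;> simp [ez]
  | succ n ih => rw [pow_succ, ih]; ext <;> simp [ez]; ring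

theorem ez_central (t : ZMod p) (g : HeisExt K) : g * ez K t = ez K t * g := by
  ext <;> simp [ez, add_comm]

theorem eq_diag_mul (g : HeisExt K) : g = diag g.b * (ex K g.x *
    (ey K ((((g.b)⁻¹ : K) : (ZMod p)ˣ) * g.y) *
      ez K (g.z - g.x * ((((g.b)⁻¹ : K) : (ZMod p)ˣ) * g.y)))) := by
  ext <;> simp [diag, ex, ey, ez]

end Basic

/-! ### Irreducible degrees of the extended Heisenberg group -/

section Rep

variable {p : ℕ} [Fact p.Prime] {K : Subgroup (ZMod p)ˣ}
  {V : Type*} [AddCommGroup V] [Module ℂ V]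
  {ρ : Representation ℂ (HeisExt K) V}

theorem map_ex_eq_one (h : ρ (ex K 1) = 1) (t : ZMod p) : ρ (ex K t) = 1 := by
  have := ex_pow (K := K) 1 t.val
  rw [ZMod.natCast_rightInverse t, mul_one] at this
  rw [← this, map_pow, h, one_pow]

theorem map_ey_eq_one (h : ρ (ey K 1) = 1) (t : ZMod p) : ρ (ey K t) = 1 := by
  have := ey_pow (K := K) 1 t.val
  rw [ZMod.natCast_rightInverse t, mul_one] at this
  rw [← this, map_pow, h, one_pow]

theorem map_ez_eq_one (h : ρ (ez K 1) = 1) (t : ZMod p) : ρ (ez K t) = 1 := by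
  have := ez_pow (K := K) 1 t.val
  rw [ZMod.natCast_rightInverse t, mul_one] at this
  rw [← this, map_pow, h, one_pow]

variable [FiniteDimensional ℂ V]

/-- The representation factors through the abelian quotient `K`. -/
theorem finrank_eq_one (hρ : ρ.IsIrreducible) (hx : ρ (ex K 1) = 1) (hy : ρ (ey K 1) = 1)
    (hz : ρ (ez K 1) = 1) : finrank ℂ V = 1 := by
  have hnt : Nontrivial V := ((isIrreducible_iff _).1 hρ).1
  have hd : ∀ g, ρ g = ρ (diag g.b) := by
    intro g
    conv_lhs => rw [eq_diag_mul g]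
    simp only [map_mul, map_ex_eq_one hx, map_ey_eq_one hy, map_ez_eq_one hz, mul_one]
  obtain ⟨v, -, hv0, hv⟩ := exists_common_eigenvector (ρ := ρ) (W := ⊤) (fun g h v => by
    rw [← Module.End.mul_apply, ← Module.End.mul_apply, ← map_mul, ← map_mul, hd (g * h),
      hd (h * g), mul_b, mul_b, mul_comm]) (fun _ _ _ => trivial) top_ne_bot
  have := finrank_eq_card_of_monomial hρ (ι := Unit) (fun _ => v) 1 (fun _ => 1)
    (fun _ _ _ => rfl) (fun _ => hv0) (by simp) (fun g _ => ⟨(), hv g⟩)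
  simpa using this

/-- If the centre acts trivially and a unipotent element acts nontrivially, then the
representation is induced from a linear character of the unipotent subgroup. -/
theorem finrank_eq_card_of_normalized (hρ : ρ.IsIrreducible) (hz : ρ (ez K 1) = 1)
    {T : HeisExt K} (hT : T ∈ unip K) (hTp : T ^ p = 1) (hT1 : ρ T ≠ 1) (e : K → ℕ)
    (he : Function.Injective e) (hlt : ∀ k, e k < p)
    (hk : ∀ k, T * diag k = diag k * T ^ e k) : finrank ℂ V = Nat.card K := by
  have := Fintype.ofFinite K
  have hp : p.Prime := Fact.out
  have hcomm : ∀ g ∈ unip K, ∀ h ∈ unip K, ∀ v, ρ g (ρ h v) = ρ h (ρ g v) := by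
    intro g hg h hh v
    have h1 : g * h = h * g * ez K (g.x * h.y - h.x * g.y) := by
      rw [mem_unip] at hg hh
      ext <;> simp [ez, hg, hh, add_comm]
    rw [← Module.End.mul_apply, ← Module.End.mul_apply, ← map_mul, ← map_mul, h1, map_mul,
      map_ez_eq_one hz, mul_one]
  -- Searching inside the range of `ρ T - 1` forces the eigenvalue of `T` on `v` to differ from 1.
  obtain ⟨v, hvW, hv0, hv⟩ := exists_common_eigenvector (ρ := ρ.comp (unip K).subtype)
    (W := LinearMap.range (ρ T - 1)) (fun g h v => hcomm g g.2 h h.2 v)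
    (by
      rintro g _ ⟨w, rfl⟩
      refine ⟨ρ g w, ?_⟩
      change ρ T (ρ g w) - ρ g w = ρ g (ρ T w - w)
      rw [map_sub, hcomm T hT g g.2])
    (by
      intro h
      rw [LinearMap.range_eq_bot, sub_eq_zero] at h
      exact hT1 h)
  obtain ⟨w, hw⟩ := hvW
  obtain ⟨μ, hμ⟩ := hv ⟨T, hT⟩
  replace hμ : ρ T v = μ • v := hμ
  have hpow : ∀ n, ρ (T ^ n) v = μ ^ n • v := by
    intro n
    induction n with
    | zero => simp
    | succ n ih => rw [pow_succ, map_mul, Module.End.mul_apply, hμ, map_smul, ih, smul_smul,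
        pow_succ, mul_comm]
  have hμp : μ ^ p = 1 := by
    have := hpow p
    rw [hTp, map_one, Module.End.one_apply] at this
    exact (smul_left_injective ℂ hv0 (by simpa using this)).symm
  -- Otherwise `T` acts on `w` and `v` as a nontrivial Jordan block, and `T ^ p = 1` would give `p •
  -- v = 0`.
  have hμ1 : μ ≠ 1 := by
    rintro rfl
    rw [one_smul] at hμ
    have hTw : ρ T w = w + v := by rw [← hw]; simp
    have : ∀ n : ℕ, ρ (T ^ n) w = w + (n : ℂ) • v := by
      intro n
      induction n with
      | zero => simp
      | succ n ih =>
        rw [pow_succ', map_mul, Module.End.mul_apply, ih, map_add, map_smul, hμ, hTw]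
        push_cast
        module
    have h := this p
    rw [hTp, map_one, Module.End.one_apply, left_eq_add, smul_eq_zero] at h
    exact h.elim (by exact_mod_cast hp.ne_zero) hv0
  have hord : orderOf μ = p := orderOf_eq_prime hμp hμ1
  rw [Nat.card_eq_fintype_card]
  -- The translates of `v` by `K` are eigenvectors of `T`, with distinct eigenvalues because `μ` has
  -- order `p` and the exponents `e k < p` are distinct.
  refine finrank_eq_card_of_monomial hρ (fun k : K => ρ (diag k) v) T (fun k => μ ^ e k)
    ?_ ?_ ?_ ?_
  · intro k k' h
    refine he (pow_injOn_Iio_orderOf ?_ ?_ h) <;> simp [hord, hlt]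
  · intro k h
    apply hv0
    rw [← Representation.inv_self_apply ρ (diag k) v, h, map_zero]
  · intro k
    rw [← Module.End.mul_apply, ← map_mul, hk, map_mul, Module.End.mul_apply, hpow, map_smul]
  · intro g k
    have hu : (diag (g.b * k))⁻¹ * (g * diag k) ∈ unip K := by
      rw [mem_unip]
      simp [diag]
    obtain ⟨c, hc⟩ := hv ⟨_, hu⟩
    refine ⟨g.b * k, c, ?_⟩
    replace hc : ρ ((diag (g.b * k))⁻¹ * (g * diag k)) v = c • v := hc
    rw [← map_smul, ← hc, ← Module.End.mul_apply, ← Module.End.mul_apply, ← map_mul, ← map_mul,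
      mul_inv_cancel_left]

theorem finrank_eq_card_of_ex (hρ : ρ.IsIrreducible) (hz : ρ (ez K 1) = 1)
    (hx : ρ (ex K 1) ≠ 1) : finrank ℂ V = Nat.card K := by
  refine finrank_eq_card_of_normalized hρ hz (T := ex K 1) rfl ?_ hx
    (fun k => ((k : (ZMod p)ˣ) : ZMod p).val) ?_ (fun k => ZMod.val_lt _) ?_
  · rw [ex_pow]
    ext <;> simp [ex]
  · intro k k' h
    exact Subtype.ext (Units.ext (ZMod.val_injective p h))
  · intro k
    rw [ex_pow]
    ext <;> simp [ex, diag]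

theorem finrank_eq_card_of_ey (hρ : ρ.IsIrreducible) (hz : ρ (ez K 1) = 1)
    (hy : ρ (ey K 1) ≠ 1) : finrank ℂ V = Nat.card K := by
  refine finrank_eq_card_of_normalized hρ hz (T := ey K 1) rfl ?_ hy
    (fun k => (((k⁻¹ : K) : (ZMod p)ˣ) : ZMod p).val) ?_ (fun k => ZMod.val_lt _) ?_
  · rw [ey_pow]
    ext <;> simp [ey]
  · intro k k' h
    exact inv_injective (Subtype.ext (Units.ext (ZMod.val_injective p h)))
  · intro k
    rw [ey_pow, ZMod.natCast_zmod_val, mul_one]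
    ext <;> simp [ey, diag, -ZMod.inv_coe_unit]

/-- A Stone–von Neumann argument: the centre acts through a primitive `p`-th root of unity `ζ`, and
`ey K j` multiplies eigenvalues of `ex K 1` by `ζ ^ j`. The `p` translates of one suitable
eigenvector then form a basis, whatever `K` is. -/
theorem finrank_eq_prime (hρ : ρ.IsIrreducible) (hz : ρ (ez K 1) ≠ 1) : finrank ℂ V = p := by
  have hp : p.Prime := Fact.out
  have hnt : Nontrivial V := ((isIrreducible_iff _).1 hρ).1
  obtain ⟨ζ, hζ⟩ := exists_scalar_of_central hρ (ez_central (K := K) 1)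
  have hζ1 : ζ ≠ 1 := by
    rintro rfl
    exact hz (LinearMap.ext fun v => (hζ v).trans (one_smul ℂ v))
  have hzpow : ∀ (n : ℕ) v, ρ (ez K n) v = ζ ^ n • v := by
    intro n v
    have h1 : ez K (n : ZMod p) = ez K 1 ^ n := by rw [ez_pow, mul_one]
    rw [h1]
    clear h1
    induction n with
    | zero => simp
    | succ n ih => rw [pow_succ, map_mul, Module.End.mul_apply, hζ, map_smul, ih, smul_smul,
        pow_succ, mul_comm]
  have hζp : ζ ^ p = 1 := by
    obtain ⟨v, hv⟩ := exists_ne (0 : V)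
    have h := hzpow p v
    have h1 : ez K (p : ZMod p) = 1 := by ext <;> simp [ez]
    rw [h1, map_one, Module.End.one_apply] at h
    exact (smul_left_injective ℂ hv (by simpa using h)).symm
  have hord : orderOf ζ = p := orderOf_eq_prime hζp hζ1
  have hcommv : ∀ (j : ZMod p) v,
      ρ (ex K 1) (ρ (ey K j) v) = ζ ^ j.val • ρ (ey K j) (ρ (ex K 1) v) := by
    intro j v
    have h1 : ex K 1 * ey K j = ez K (j.val : ZMod p) * (ey K j * ex K 1) := by
      ext <;> simp [ex, ey, ez]
    rw [← Module.End.mul_apply, ← map_mul, h1, map_mul, Module.End.mul_apply, hzpow, map_mul,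
      Module.End.mul_apply]
  -- Conjugation by `diag k` turns `ex K 1` into a power of itself, so the eigenspace for 1 is
  -- stable under `K`, and a vector in it can be chosen to be an eigenvector of `K` too.
  obtain ⟨v, hvW, hv0, hv⟩ := exists_common_eigenvector
    (ρ := ρ.comp (⟨⟨diag, rfl⟩, fun k l => by ext <;> simp [diag]⟩ : K →* HeisExt K))
    (W := End.eigenspace (ρ (ex K 1)) 1)
    (fun k l v => by
      change ρ (diag k) (ρ (diag l) v) = ρ (diag l) (ρ (diag k) v)
      have h1 : diag k * diag l = diag l * diag k := by ext <;> simp [diag, mul_comm]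
      rw [← Module.End.mul_apply, ← map_mul, h1, map_mul, Module.End.mul_apply])
    (by
      intro k w hw
      rw [End.mem_eigenspace_iff, one_smul] at hw ⊢
      change ρ (ex K 1) (ρ (diag k) w) = ρ (diag k) w
      have h1 : ex K 1 * diag k = diag k * ex K 1 ^ ((k : (ZMod p)ˣ) : ZMod p).val := by
        rw [ex_pow]
        ext <;> simp [ex, diag]
      have h2 : ∀ n : ℕ, ρ (ex K 1 ^ n) w = w := by
        intro n
        induction n with
        | zero => simp
        | succ n ih => rw [pow_succ, map_mul, Module.End.mul_apply, hw, ih]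
      rw [← Module.End.mul_apply, ← map_mul, h1, map_mul, Module.End.mul_apply, h2])
    (by
      obtain ⟨μ, hμ⟩ := End.exists_eigenvalue (ρ (ex K 1))
      obtain ⟨w, hw, hw0⟩ := hμ.exists_hasEigenvector
      rw [End.mem_eigenspace_iff] at hw
      have hpow : ∀ n, ρ (ex K 1 ^ n) w = μ ^ n • w := by
        intro n
        induction n with
        | zero => simp
        | succ n ih => rw [pow_succ, map_mul, Module.End.mul_apply, hw, map_smul, ih, smul_smul,
            pow_succ, mul_comm]
      have hμp : μ ^ p = 1 := by
        have h := hpow p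
        have h1 : ex K 1 ^ p = 1 := by
          rw [ex_pow]
          ext <;> simp [ex]
        rw [h1, map_one, Module.End.one_apply] at h
        exact (smul_left_injective ℂ hw0 (by simpa using h)).symm
      have hprim : IsPrimitiveRoot ζ p := hord ▸ IsPrimitiveRoot.orderOf ζ
      have hinv : μ⁻¹ ^ p = 1 := by rw [inv_pow, hμp, inv_one]
      -- With `ζ ^ i = μ⁻¹`, the operator `ey K i` carries the `μ`-eigenvector `w` to eigenvalue 1.
      obtain ⟨i, hi, hiμ⟩ := hprim.eq_pow_of_pow_eq_one hinv
      have hμ0 : μ ≠ 0 := by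
        rintro rfl
        rw [zero_pow hp.ne_zero] at hμp
        exact zero_ne_one hμp
      intro hbot
      have hmem : ρ (ey K i) w ∈ End.eigenspace (ρ (ex K 1)) 1 := by
        rw [End.mem_eigenspace_iff, hcommv, hw, map_smul, smul_smul, ZMod.val_natCast,
          Nat.mod_eq_of_lt hi, hiμ, inv_mul_cancel₀ hμ0]
      rw [hbot, Submodule.mem_bot] at hmem
      apply hw0
      rw [← Representation.inv_self_apply ρ (ey K i) w, hmem, map_zero])
  rw [End.mem_eigenspace_iff, one_smul] at hvW
  have hxv : ∀ t, ρ (ex K t) v = v := by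
    intro t
    have := ex_pow (K := K) 1 t.val
    rw [ZMod.natCast_rightInverse t, mul_one] at this
    rw [← this]
    generalize t.val = n
    induction n with
    | zero => simp
    | succ n ih => rw [pow_succ, map_mul, Module.End.mul_apply, hvW, ih]
  have := finrank_eq_card_of_monomial hρ (fun j : ZMod p => ρ (ey K j) v) (ex K 1)
    (fun j => ζ ^ j.val) ?_ ?_ ?_ ?_
  · rw [this, ZMod.card]
  · intro k k' h
    refine ZMod.val_injective p (pow_injOn_Iio_orderOf ?_ ?_ h) <;> simp [hord, ZMod.val_lt]
  · intro k h
    apply hv0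
    rw [← Representation.inv_self_apply ρ (ey K k) v, h, map_zero]
  · intro k
    rw [hcommv, hvW]
  · intro g j
    obtain ⟨c, hc⟩ := hv g.b
    replace hc : ρ (diag g.b) v = c • v := hc
    have h1 : g * ey K j = ez K ((g.z + g.x * j).val : ZMod p) *
        (ey K (((g.b : (ZMod p)ˣ) : ZMod p) * j + g.y) * (diag g.b * ex K g.x)) := by
      ext <;> simp [ex, ey, ez, diag]
    refine ⟨((g.b : (ZMod p)ˣ) : ZMod p) * j + g.y, ζ ^ (g.z + g.x * j).val * c, ?_⟩
    rw [← Module.End.mul_apply, ← map_mul, h1, map_mul, Module.End.mul_apply, hzpow, map_mul,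
      Module.End.mul_apply, map_mul, Module.End.mul_apply, hxv, hc, map_smul, smul_smul]

end Rep

theorem cd_eq {p : ℕ} [Fact p.Prime] (K : Subgroup (ZMod p)ˣ) :
    cd (HeisExt K) = {1, p, Nat.card K} := by
  ext d
  simp only [Set.mem_insert_iff, Set.mem_singleton_iff]
  constructor
  · rw [mem_cd_iff]
    rintro ⟨V, _, _, _, ρ, hρ, rfl⟩
    by_cases hz : ρ (ez K 1) = 1
    · by_cases hx : ρ (ex K 1) = 1
      · by_cases hy : ρ (ey K 1) = 1
        · exact Or.inl (finrank_eq_one hρ hx hy hz)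
        · exact Or.inr (Or.inr (finrank_eq_card_of_ey hρ hz hy))
      · exact Or.inr (Or.inr (finrank_eq_card_of_ex hρ hz hx))
    · exact Or.inr (Or.inl (finrank_eq_prime hρ hz))
  · rintro (rfl | rfl | rfl)
    · exact one_mem_cd _
    · rw [mem_cd_iff]
      obtain ⟨Q, hQ, h⟩ := exists_irreducible_apply_ne_one
        (Representation.ofMulAction ℂ (HeisExt K) (HeisExt K)) (g := ez K 1) (ofMulAction_ne_one (x := 1) fun h => by
          simpa [ez] using congrArg HeisExt.z h)
      exact ⟨Q.toSubmodule, _, _, inferInstance, _, hQ, finrank_eq_prime hQ h⟩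
    -- In the affine action `t ↦ b t + y` the centre is trivial while `ey K 1` moves 0, so some
    -- constituent has degree `|K|`.
    · let act : MulAction (HeisExt K) (ZMod p) :=
        { smul := fun g t => ((g.b : (ZMod p)ˣ) : ZMod p) * t + g.y
          one_smul := fun t => by
            change ((((1 : HeisExt K).b : (ZMod p)ˣ) : ZMod p)) * t + (1 : HeisExt K).y = t
            simp
          mul_smul := fun g h t => by
            change (((g * h).b : (ZMod p)ˣ) : ZMod p) * t + (g * h).y =
              ((g.b : (ZMod p)ˣ) : ZMod p) * (((h.b : (ZMod p)ˣ) : ZMod p) * t + h.y) + g.y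
            simp
            ring }
      have hact : ∀ (g : HeisExt K) (t : ZMod p),
        g • t = ((g.b : (ZMod p)ˣ) : ZMod p) * t + g.y := fun _ _ => rfl
      rw [mem_cd_iff]
      obtain ⟨Q, hQ, h⟩ := exists_irreducible_apply_ne_one
        (Representation.ofMulAction ℂ (HeisExt K) (ZMod p)) (g := ey K 1) (ofMulAction_ne_one (x := 0) fun h => by
          simp [hact, ey] at h)
      refine ⟨Q.toSubmodule, _, _, inferInstance, _, hQ, finrank_eq_card_of_ey hQ ?_ h⟩
      ext v : 2
      change Representation.ofMulAction ℂ (HeisExt K) (ZMod p) (ez K 1) v = v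
      rw [ofMulAction_eq_one fun t => by simp [hact, ez], Module.End.one_apply]

end HeisExt

end CharDegree

/-! ### Complements of star forests as degree graphs -/

namespace CharDegree

/-- A disjoint union of stars, the `i`-th one having `m i` leaves. -/
def starForest {r : ℕ} (m : Fin r → ℕ) : SimpleGraph (Σ i, Option (Fin (m i))) where
  Adj u v := u.1 = v.1 ∧ u.2.isSome ≠ v.2.isSome
  symm := ⟨fun _ _ h => ⟨h.1.symm, h.2.symm⟩⟩
  loopless := ⟨fun _ h => h.2 rfl⟩

theorem exists_subgroup_card {p N : ℕ} [Fact p.Prime] (h : N ∣ p - 1) :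
    ∃ K : Subgroup (ZMod p)ˣ, Nat.card K = N := by
  have hp : p.Prime := Fact.out
  obtain ⟨g, hg⟩ := IsCyclic.exists_ofOrder_eq_natCard (α := (ZMod p)ˣ)
  rw [Nat.card_eq_fintype_card, ZMod.card_units] at hg
  obtain ⟨d, hd⟩ := h
  have hpos : 0 < p - 1 := Nat.sub_pos_of_lt hp.one_lt
  have hd0 : d ≠ 0 := by
    rintro rfl
    omega
  refine ⟨Subgroup.zpowers (g ^ d), ?_⟩
  rw [Nat.card_zpowers, orderOf_pow_of_dvd hd0 (hg ▸ hd ▸ Dvd.intro_left N rfl), hg, hd,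
    Nat.mul_div_cancel _ (Nat.pos_of_ne_zero hd0)]

theorem cd_punit : cd PUnit = {1} := by
  ext d
  simp only [Set.mem_singleton_iff]
  constructor
  · rw [mem_cd_iff]
    rintro ⟨V, _, _, _, ρ, hρ, rfl⟩
    have : IsMulCommutative PUnit.{1} := ⟨⟨fun _ _ => rfl⟩⟩
    exact Representation.IsIrreducible.finrank_eq_one_of_isMulCommutative ρ
  · rintro rfl
    exact one_mem_cd _

theorem exists_solvable_cd (p N : ℕ → ℕ) (hp : ∀ i, (p i).Prime) (hN : ∀ i, N i ∣ p i - 1)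
    (r : ℕ) : ∃ (G : Type) (_ : Group G), Finite G ∧ Group.IsSolvable G ∧
      cd G = {d | ∃ f : ℕ → ℕ, (∀ i, f i ∈ ({1, p i, N i} : Set ℕ)) ∧
        d = ∏ i ∈ Finset.range r, f i} := by
  induction r with
  | zero =>
    refine ⟨PUnit, inferInstance, inferInstance, inferInstance, ?_⟩
    rw [cd_punit]
    ext d
    simp only [Set.mem_singleton_iff, Finset.range_zero, Finset.prod_empty, Set.mem_ofPred_eq]
    exact ⟨fun h => ⟨fun _ => 1, fun _ => Or.inl rfl, h⟩, fun ⟨_, _, h⟩ => h⟩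
  | succ r ih =>
    obtain ⟨G, _, _, _, hG⟩ := ih
    have : Fact (p r).Prime := ⟨hp r⟩
    obtain ⟨K, hK⟩ := exists_subgroup_card (hN r)
    refine ⟨G × HeisExt K, inferInstance, inferInstance, inferInstance, ?_⟩
    ext d
    rw [mem_cd_prod_iff, hG, HeisExt.cd_eq, hK]
    simp only [Finset.prod_range_succ]
    constructor
    · rintro ⟨_, ⟨f, hf, rfl⟩, b, hb, rfl⟩
      refine ⟨Function.update f r b, fun i => ?_, ?_⟩
      · rcases eq_or_ne i r with rfl | h
        · rwa [Function.update_self]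
        · rw [Function.update_of_ne h]
          exact hf i
      · rw [Function.update_self]
        congr 1
        refine Finset.prod_congr rfl fun i hi => ?_
        rw [Function.update_of_ne (Finset.mem_range.1 hi).ne]
    · rintro ⟨f, hf, rfl⟩
      exact ⟨_, ⟨f, hf, rfl⟩, _, hf r, rfl⟩

/-- There are arbitrarily large primes congruent to 1 modulo any given positive integer.
Monotonicity keeps the `p i` distinct, and the bound `M` keeps them away from the leaf primes. -/
theorem exists_prime_labels (q : ℕ → ℕ → ℕ) (hq : ∀ i x, (q i x).Prime) (m : ℕ → ℕ) (M : ℕ) :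
    ∃ p : ℕ → ℕ, StrictMono p ∧
      ∀ i, (p i).Prime ∧ (∏ x ∈ Finset.range (m i), q i x) ∣ p i - 1 ∧ M < p i := by
  apply Filter.extraction_forall_of_frequently
    (P := fun i p => p.Prime ∧ (∏ x ∈ Finset.range (m i), q i x) ∣ p - 1 ∧ M < p)
  intro i
  rw [Filter.frequently_atTop]
  intro a
  obtain ⟨p, hp, hlt, hmod⟩ := Nat.exists_prime_gt_modEq_one (max a M)
    (k := ∏ x ∈ Finset.range (m i), q i x)
    (Finset.prod_ne_zero_iff.2 fun x _ => (hq i x).ne_zero)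
  exact ⟨p, (le_max_left _ _).trans hlt.le, hp,
    (Nat.modEq_iff_dvd' hp.one_lt.le).1 hmod.symm, (le_max_right _ _).trans_lt hlt⟩

/-- The centre of star `i` is labelled `p i` and its leaves by the prime factors of `N i`. A degree
picks one of `1, p i, N i` for each `i`, so only a centre and a leaf of the same star exclude each
other. -/
theorem isSolvableDegreeGraph_compl_starForest {r : ℕ} (m : Fin r → ℕ) :
    IsSolvableDegreeGraph (starForest m)ᶜ := by
  let q : ℕ → ℕ → ℕ := fun i x => Nat.nth Nat.Prime (Nat.pair i x)
  have hq : ∀ i x, (q i x).Prime := fun i x => Nat.prime_nth_prime _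
  have hqi : ∀ {i x j y}, q i x = q j y → i = j ∧ x = y := fun {i x j y} h => by
    have := Nat.nth_injective Nat.infinite_setOfPred_prime h
    rwa [Nat.pair_eq_pair] at this
  let m' : ℕ → ℕ := fun i => if h : i < r then m ⟨i, h⟩ else 0
  have hm' : ∀ i : Fin r, m' i = m i := fun i => by simp [m']
  obtain ⟨M, hM⟩ : ∃ M, ∀ (i : Fin r) (x : Fin (m i)), q i x ≤ M := by
    refine ⟨∑ u : Σ i, Fin (m i), q u.1 u.2, fun i x => ?_⟩
    exact Finset.single_le_sum (f := fun u : Σ i, Fin (m i) => q u.1 u.2)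
      (fun _ _ => Nat.zero_le _) (Finset.mem_univ (⟨i, x⟩ : Σ i, Fin (m i)))
  obtain ⟨p, hpm, hp⟩ := exists_prime_labels q hq m' M
  let N : ℕ → ℕ := fun i => ∏ x ∈ Finset.range (m' i), q i x
  obtain ⟨G, _, hfin, hsol, hcd⟩ := exists_solvable_cd p N (fun i => (hp i).1)
    (fun i => (hp i).2.1) r
  have hpq : ∀ (i j : Fin r) (x : Fin (m j)), p i ≠ q j x := fun i j x =>
    ((hM j x).trans_lt (hp i).2.2).ne'
  let lab : (Σ i, Option (Fin (m i))) → ℕ := fun u => u.2.elim (p u.1) fun x => q u.1 x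
  have hlabp : ∀ u, (lab u).Prime := by
    rintro ⟨i, _ | x⟩
    exacts [(hp i).1, hq i x]
  have hlabi : Function.Injective lab := by
    rintro ⟨i, _ | x⟩ ⟨j, _ | y⟩ h
    · have : i = j := Fin.ext (hpm.injective h)
      rw [this]
    · exact absurd h (hpq i j y)
    · exact absurd h.symm (hpq j i x)
    · obtain ⟨h1, h2⟩ := hqi h
      obtain rfl : i = j := Fin.ext h1
      obtain rfl : x = y := Fin.ext h2
      rfl
  -- the factor of a degree at `i` divisible by the label of a vertex
  let val : (Σ i, Option (Fin (m i))) → ℕ := fun u => u.2.elim (p u.1) fun _ => N u.1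
  have hqN : ∀ (i : Fin r) (x : Fin (m i)), q i x ∣ N i := fun i x =>
    Finset.dvd_prod_of_mem _ (Finset.mem_range.2 (by rw [hm']; exact x.2))
  have hval : ∀ u, lab u ∣ val u := by
    rintro ⟨i, _ | x⟩
    exacts [dvd_rfl, hqN i x]
  have hvalmem : ∀ u, val u ∈ ({1, p u.1, N u.1} : Set ℕ) := by
    rintro ⟨i, _ | x⟩
    exacts [Or.inr (Or.inl rfl), Or.inr (Or.inr rfl)]
  have hpN : ∀ i j : Fin r, ¬ p i ∣ N j := by
    intro i j h
    obtain ⟨x, hx, hd⟩ := (Prime.dvd_finsetProd_iff (hp i).1.prime _).1 h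
    rw [Finset.mem_range, hm'] at hx
    exact hpq i j ⟨x, hx⟩ ((Nat.prime_dvd_prime_iff_eq (hp i).1 (hq j x)).1 hd)
  -- a prime dividing an admissible factor is a label
  have hdvd : ∀ (s : ℕ) (i : Fin r) (d : ℕ), s.Prime → d ∈ ({1, p i, N i} : Set ℕ) → s ∣ d →
      ∃ u, lab u = s ∧ u.1 = i ∧ d = val u := by
    rintro s i d hs (rfl | rfl | rfl) h
    · exact absurd (Nat.dvd_one.1 h) hs.one_lt.ne'
    · exact ⟨⟨i, none⟩, ((Nat.prime_dvd_prime_iff_eq hs (hp i).1).1 h).symm, rfl, rfl⟩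
    · obtain ⟨x, hx, hd⟩ := (Prime.dvd_finsetProd_iff hs.prime _).1 h
      rw [Finset.mem_range, hm'] at hx
      exact ⟨⟨i, some ⟨x, hx⟩⟩, ((Nat.prime_dvd_prime_iff_eq hs (hq i x)).1 hd).symm, rfl, rfl⟩
  have hprod : ∀ (f : ℕ → ℕ) (s : ℕ), s.Prime → (∀ i, f i ∈ ({1, p i, N i} : Set ℕ)) →
      s ∣ ∏ i ∈ Finset.range r, f i → ∃ u, lab u = s ∧ f u.1 = val u := by
    intro f s hs hf h
    obtain ⟨i, hi, hd⟩ := (Prime.dvd_finsetProd_iff hs.prime _).1 h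
    obtain ⟨u, hu, hui, hv⟩ := hdvd s ⟨i, Finset.mem_range.1 hi⟩ (f i) hs (hf i) hd
    refine ⟨u, hu, ?_⟩
    rw [hui]
    exact hv
  -- one factor prescribed
  have hmem : ∀ u, lab u ∈ rho G := by
    intro u
    refine ⟨hlabp u, ∏ i ∈ Finset.range r, (if i = u.1 then val u else 1), ?_, ?_⟩
    · rw [hcd]
      refine ⟨_, fun i => ?_, rfl⟩
      split_ifs with h
      · rw [h]; exact hvalmem u
      · exact Or.inl rfl
    · rw [Finset.prod_ite_eq' , if_pos (Finset.mem_range.2 u.1.2)]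
      exact hval u
  let e : (Σ i, Option (Fin (m i))) ≃ rho G := Equiv.ofBijective (fun u => ⟨lab u, hmem u⟩) <| by
    refine ⟨fun u v h => hlabi (congrArg Subtype.val h), ?_⟩
    rintro ⟨s, hs, d, hd, hsd⟩
    rw [hcd] at hd
    obtain ⟨f, hf, rfl⟩ := hd
    obtain ⟨u, hu, -⟩ := hprod f s hs hf hsd
    exact ⟨u, Subtype.ext hu⟩
  refine ⟨G, _, hfin, hsol, ⟨⟨e, ?_⟩⟩⟩
  intro u v
  change (e u ≠ e v ∧ ∃ d ∈ cd G, lab u * lab v ∣ d) ↔ u ≠ v ∧ ¬ (u.1 = v.1 ∧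
    u.2.isSome ≠ v.2.isSome)
  rw [e.injective.ne_iff]
  refine and_congr_right fun huv => ?_
  have hcop : Nat.Coprime (lab u) (lab v) :=
    (Nat.coprime_primes (hlabp u) (hlabp v)).2 (hlabi.ne huv)
  constructor
  · rintro ⟨d, hd, hdiv⟩ ⟨h1, h2⟩
    rw [hcd] at hd
    obtain ⟨f, hf, rfl⟩ := hd
    obtain ⟨u', hu, hfu⟩ := hprod f _ (hlabp u) hf ((Dvd.intro _ rfl).trans hdiv)
    obtain ⟨v', hv, hfv⟩ := hprod f _ (hlabp v) hf ((Dvd.intro_left _ rfl).trans hdiv)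
    obtain rfl := hlabi hu
    obtain rfl := hlabi hv
    -- Both labels require the factor at the same index, which would have to equal `p i` and `N i`
    -- at once.
    rw [h1, hfv] at hfu
    obtain ⟨i, a⟩ := u'
    obtain ⟨j, b⟩ := v'
    obtain rfl : i = j := h1
    rcases a with _ | a <;> rcases b with _ | b
    · simp at h2
    · exact hpN i i ⟨1, by rw [mul_one]; exact hfu⟩
    · exact hpN i i ⟨1, by rw [mul_one]; exact hfu.symm⟩
    · simp at h2
  · intro h
    refine ⟨∏ i ∈ Finset.range r, (if i = u.1 then val u else if i = v.1 then val v else 1),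
      ?_, hcop.mul_dvd_of_dvd_of_dvd ?_ ?_⟩
    · rw [hcd]
      refine ⟨_, fun i => ?_, rfl⟩
      split_ifs with h1 h2
      · rw [h1]; exact hvalmem u
      · rw [h2]; exact hvalmem v
      · exact Or.inl rfl
    · refine Dvd.dvd.trans ?_ (Finset.dvd_prod_of_mem _ (Finset.mem_range.2 u.1.2))
      rw [if_pos rfl]
      exact hval u
    · refine Dvd.dvd.trans ?_ (Finset.dvd_prod_of_mem _ (Finset.mem_range.2 v.1.2))
      by_cases h1 : u.1 = v.1
      · rw [if_pos (by rw [h1])]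
        have h2 : u.2.isSome = v.2.isSome := by
          by_contra h2
          exact h ⟨h1, h2⟩
        have : val u = val v := by
          obtain ⟨i, a⟩ := u
          obtain ⟨j, b⟩ := v
          obtain rfl : i = j := h1
          rcases a with _ | a <;> rcases b with _ | b
          · rfl
          · simp at h2
          · simp at h2
          · rfl
        rw [this]
        exact hval v
      · rw [if_neg (fun h => h1 (Fin.ext h.symm)), if_pos rfl]
        exact hval v

end CharDegree

namespace CharDegree

open SimpleGraph

/-! ### Euler circuits -/

section Eulerian

variable {V : Type*} {Γ : SimpleGraph V}

theorem mem_edges_of_longest_trail {u v w : V} {p : Γ.Walk u v} (hp : p.IsTrail)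
    (hmax : ∀ (u' v' : V) (p' : Γ.Walk u' v'), p'.IsTrail → p'.length ≤ p.length)
    (h : Γ.Adj w u) : s(w, u) ∈ p.edges := by
  by_contra he
  have := hmax _ _ (Walk.cons h p) (Walk.isTrail_cons h p |>.2 ⟨hp, he⟩)
  rw [Walk.length_cons] at this
  omega

open Classical in
theorem exists_eulerian_circuit [Fintype V] (hc : Γ.Connected) (hd : ∀ v, Even (Γ.degree v)) :
    ∃ (v : V) (w : Γ.Walk v v), w.IsEulerian ∧ ∀ u, u ∈ w.support := by
  have := hc.nonempty
  obtain ⟨u, v, p, hp, hmax⟩ := Walk.exists_isTrail_forall_isTrail_length_le_length Γ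
  have huv : u = v := by
    by_contra hne
    -- A trail with distinct ends has an odd number of edges at `u`; a longest one uses every edge
    -- at `u`, and that number is even.
    have h1 := (hp.even_countP_edges_iff u).not.2 fun h => (h hne).1 rfl
    apply h1
    have h2 : (p.edges.filter (fun e => u ∈ e)).toFinset = Γ.incidenceFinset u := by
      ext e
      rw [List.mem_toFinset, List.mem_filter, mem_incidenceFinset, decide_eq_true_eq]
      refine ⟨fun h => ⟨p.edges_subset_edgeSet h.1, h.2⟩, fun h => ⟨?_, h.2⟩⟩
      obtain ⟨w, rfl⟩ := Sym2.mem_iff_exists.1 h.2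
      rw [Sym2.eq_swap]
      exact mem_edges_of_longest_trail hp hmax ((Γ.mem_edgeSet).1 h.1).symm
    rw [List.countP_eq_length_filter, ← List.toFinset_card_of_nodup (hp.edges_nodup.filter _), h2,
      card_incidenceFinset_eq_degree]
    exact hd u
  subst huv
  -- A longest closed trail stays longest when rotated to start at `x`, so no edge at `x` is unused.
  have key : ∀ x ∈ p.support, ∀ w, Γ.Adj x w → s(x, w) ∈ p.edges := by
    intro x hx w hw
    have h := mem_edges_of_longest_trail (hp.rotate hx)
      (fun u' v' p' hp' => by rw [Walk.length_rotate]; exact hmax u' v' p' hp') hw.symm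
    rw [(p.rotate_edges x hx).mem_iff, Sym2.eq_swap] at h
    exact h
  have hsupp : ∀ x, x ∈ p.support := by
    intro x
    by_contra hx
    obtain ⟨q⟩ := hc.preconnected u x
    obtain ⟨d, -, h1, h2⟩ := q.exists_boundary_dart {y | y ∈ p.support} p.start_mem_support hx
    exact h2 (p.snd_mem_support_of_mem_edges (key _ h1 _ d.adj))
  refine ⟨u, p, hp.isEulerian_of_forall_mem fun e => ?_, hsupp⟩
  induction e with
  | h x y => exact fun h => key x (hsupp x) y h

end Eulerian

/-! ### Blocks of diameter two -/

section Block

variable {V : Type} {Γ : SimpleGraph V}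

/-- Any two nonadjacent vertices have at least two common neighbours. -/
def HasTwoCommonNeighbors {V : Type*} (Γ : SimpleGraph V) : Prop :=
  ∀ u v, u ≠ v → Γ.Adj u v ∨
    ∃ x y, x ≠ y ∧ Γ.Adj u x ∧ Γ.Adj x v ∧ Γ.Adj u y ∧ Γ.Adj y v

theorem HasTwoCommonNeighbors.of_iso {V W : Type*} {Γ : SimpleGraph V} {Γ' : SimpleGraph W}
    (φ : Γ ≃g Γ') (h : HasTwoCommonNeighbors Γ') : HasTwoCommonNeighbors Γ := by
  intro u v huv
  rcases h (φ u) (φ v) (φ.injective.ne huv) with h | ⟨x, y, hxy, h1, h2, h3, h4⟩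
  · exact Or.inl (φ.map_adj_iff.1 h)
  · refine Or.inr ⟨φ.symm x, φ.symm y, φ.symm.injective.ne hxy, ?_, ?_, ?_, ?_⟩ <;>
      rw [← φ.map_adj_iff, φ.apply_symm_apply] <;> assumption

theorem HasTwoCommonNeighbors.connected [Nonempty V] (h : HasTwoCommonNeighbors Γ) :
    Γ.Connected := by
  refine ⟨fun u v => ?_⟩
  rcases eq_or_ne u v with rfl | huv
  · exact Reachable.refl u
  · rcases h u v huv with h | ⟨x, -, -, h1, h2, -⟩
    · exact h.reachable
    · exact h1.reachable.trans h2.reachable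

/-- Deleting one vertex leaves at least one of the two common neighbours. -/
theorem HasTwoCommonNeighbors.isBlock [Nonempty V] (h : HasTwoCommonNeighbors Γ) :
    IsBlock Γ := by
  refine ⟨h.connected, fun w hw => ?_⟩
  have h1 : (Γ.induce {w}ᶜ).Preconnected := by
    rintro ⟨u, hu⟩ ⟨v, hv⟩
    have adj : ∀ {a b : V} (ha : a ∈ ({w}ᶜ : Set V)) (hb : b ∈ ({w}ᶜ : Set V)), Γ.Adj a b →
        (Γ.induce {w}ᶜ).Reachable ⟨a, ha⟩ ⟨b, hb⟩ := fun ha hb hab =>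
      Adj.reachable (G := Γ.induce {w}ᶜ) (u := ⟨_, ha⟩) (v := ⟨_, hb⟩) hab
    rcases eq_or_ne u v with rfl | huv
    · exact Reachable.refl _
    · rcases h u v huv with h | ⟨x, y, hxy, h1, h2, h3, h4⟩
      · exact adj hu hv h
      · by_cases hx : x = w
        · have hy : y ∈ ({w}ᶜ : Set V) := fun e => hxy (hx.trans (Set.mem_singleton_iff.1 e).symm)
          exact (adj hu hy h3).trans (adj hy hv h4)
        · exact (adj hu hx h1).trans (adj hx hv h2)
  have h2 := h1.subsingleton_connectedComponent
  have h3 := Finite.card_le_one_iff_subsingleton.2 h2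
  have h4 := h.connected.preconnected.subsingleton_connectedComponent
  have h5 : 0 < Nat.card Γ.ConnectedComponent := Nat.card_pos
  unfold IsCutVertex at hw
  omega

theorem HasTwoCommonNeighbors.ediam_eq_two [Nontrivial V] (h : HasTwoCommonNeighbors Γ)
    (ht : Γ ≠ ⊤) : Γ.ediam = 2 := by
  have h1 : Γ.ediam ≤ 2 := by
    rw [ediam_le_iff]
    intro u v
    rcases eq_or_ne u v with rfl | huv
    · simp
    · rcases h u v huv with h | ⟨x, -, -, h1, h2, -⟩
      · exact (edist_le (Walk.cons h Walk.nil)).trans (by simp)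
      · exact (edist_le (Walk.cons h1 (Walk.cons h2 Walk.nil))).trans (by simp)
  have h2 : Γ.ediam ≠ 0 := ediam_ne_zero
  have h3 : Γ.ediam ≠ 1 := ediam_eq_one.not.2 ht
  generalize Γ.ediam = d at *
  induction d with
  | top => simp at h1
  | coe d =>
    norm_cast at *
    omega

end Block

/-! ### Degrees and invariants of star forests -/

section StarForest

variable {r : ℕ} {m : Fin r → ℕ}

theorem degree_starForest_none (i : Fin r) [Fintype ((starForest m).neighborSet ⟨i, none⟩)] :
    (starForest m).degree ⟨i, none⟩ = m i := by
  classical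
  have : (starForest m).neighborFinset ⟨i, none⟩ =
      Finset.univ.image (fun x : Fin (m i) => (⟨i, some x⟩ : Σ i, Option (Fin (m i)))) := by
    ext ⟨j, _ | y⟩
    · rw [mem_neighborFinset]
      refine iff_of_false (fun h => h.2 rfl) fun h => ?_
      obtain ⟨x, -, hx⟩ := Finset.mem_image.1 h
      obtain rfl : i = j := congrArg Sigma.fst hx
      simp at hx
    · rw [mem_neighborFinset]
      constructor
      · rintro ⟨h, -⟩
        obtain rfl : i = j := h
        simp
      · intro h
        obtain ⟨x, -, hx⟩ := Finset.mem_image.1 h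
        exact ⟨(congrArg Sigma.fst hx :), by simp⟩
  rw [← card_neighborFinset_eq_degree, this, Finset.card_image_of_injective, Finset.card_fin]
  intro x y h
  simpa using h

theorem degree_starForest_some (i : Fin r) (x : Fin (m i))
    [Fintype ((starForest m).neighborSet ⟨i, some x⟩)] :
    (starForest m).degree ⟨i, some x⟩ = 1 := by
  have : (starForest m).neighborFinset ⟨i, some x⟩ = {⟨i, none⟩} := by
    ext ⟨j, _ | y⟩
    · rw [mem_neighborFinset, Finset.mem_singleton]
      constructor
      · rintro ⟨h, -⟩
        obtain rfl : i = j := h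
        rfl
      · intro h
        exact ⟨(congrArg Sigma.fst h).symm, by simp⟩
    · rw [mem_neighborFinset, Finset.mem_singleton]
      refine iff_of_false (fun h => h.2 rfl) fun h => ?_
      obtain rfl : j = i := congrArg Sigma.fst h
      simp at h
  rw [← card_neighborFinset_eq_degree, this, Finset.card_singleton]

/-- Vertices nonadjacent in the complement lie in one star, and every vertex of another star, which
has at least two, is joined to both. -/
theorem hasTwoCommonNeighbors_compl_starForest (hr : 2 ≤ r) (hm : ∀ i, 0 < m i) :
    HasTwoCommonNeighbors (starForest m)ᶜ := by
  intro u v huv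
  by_cases h : (starForest m).Adj u v
  · right
    have : Nontrivial (Fin r) := Fin.nontrivial_iff_two_le.2 hr
    obtain ⟨j, hj⟩ := exists_ne u.1
    have hj' : j ≠ v.1 := h.1 ▸ hj
    have adj : ∀ {a b : Σ i, Option (Fin (m i))}, a.1 ≠ b.1 → (starForest m)ᶜ.Adj a b :=
      fun hab => ⟨fun e => hab (congrArg Sigma.fst e), fun e => hab e.1⟩
    exact ⟨⟨j, none⟩, ⟨j, some ⟨0, hm j⟩⟩, by simp, adj hj.symm, adj hj', adj hj.symm, adj hj'⟩
  · exact Or.inl ⟨huv, h⟩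

open Classical in
-- With `g` arbitrary, these sums encode the degree sequence; `id` and squaring suffice later.
theorem sum_degree_starForest (g : ℕ → ℕ) :
    ∑ v, g ((starForest m).degree v) = ∑ i, (g (m i) + m i * g 1) := by
  rw [Fintype.sum_sigma]
  refine Finset.sum_congr rfl fun i _ => ?_
  rw [Fintype.sum_option, degree_starForest_none]
  simp [degree_starForest_some]

/-- Isomorphic complements come from isomorphic graphs. -/
def isoOfCompl {V W : Type*} {Γ : SimpleGraph V} {Γ' : SimpleGraph W} (φ : Γᶜ ≃g Γ'ᶜ) :
    Γ ≃g Γ' where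
  toEquiv := φ.toEquiv
  map_rel_iff' := fun {u v} => by
    have h := φ.map_adj_iff (v := u) (w := v)
    simp only [compl_adj, φ.injective.ne_iff] at h
    change Γ'.Adj (φ u) (φ v) ↔ Γ.Adj u v
    rcases eq_or_ne u v with rfl | huv
    · simp
    · tauto

theorem sum_eq_of_iso {r' : ℕ} {m' : Fin r' → ℕ} (φ : (starForest m)ᶜ ≃g (starForest m')ᶜ)
    (g : ℕ → ℕ) : ∑ i, (g (m i) + m i * g 1) = ∑ i, (g (m' i) + m' i * g 1) := by
  classical
  rw [← sum_degree_starForest, ← sum_degree_starForest]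
  exact Fintype.sum_equiv (isoOfCompl φ).toEquiv _ _ fun v => by
    rw [← (isoOfCompl φ).degree_eq v]
    rfl

theorem mem_classG_and_isEulerian {n : ℕ} {Γ : SimpleGraph (Fin n)} (φ : Γ ≃g (starForest m)ᶜ)
    (hr : 2 ≤ r) (hm : ∀ i, Odd (m i)) {i : Fin r} (hi : m i ≠ 1) :
    Γ ∈ classG n ∧ IsEulerian Γ := by
  classical
  have hpos : ∀ i, 0 < m i := fun i => (hm i).pos
  have h2 : HasTwoCommonNeighbors Γ := (hasTwoCommonNeighbors_compl_starForest hr hpos).of_iso φ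
  let c : Σ i, Option (Fin (m i)) := ⟨i, none⟩
  let l : Σ i, Option (Fin (m i)) := ⟨i, some ⟨0, hpos i⟩⟩
  have hcl : (starForest m).Adj c l := ⟨rfl, by simp [c, l]⟩
  have hnt : Nontrivial (Fin n) := ⟨φ.symm c, φ.symm l, φ.symm.injective.ne hcl.ne⟩
  have htop : Γ ≠ ⊤ := by
    rintro rfl
    have h : (⊤ : SimpleGraph (Fin n)).Adj (φ.symm c) (φ.symm l) := φ.symm.injective.ne hcl.ne
    rw [← φ.map_adj_iff, φ.apply_symm_apply, φ.apply_symm_apply] at h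
    exact h.2 hcl
  have hdeg : ∀ v, Γ.degree v = Fintype.card (Σ i, Option (Fin (m i))) - 1 -
      (starForest m).degree (φ v) := fun v => by
    rw [← degree_compl, φ.degree_eq]
  -- Each star has `m i + 1` vertices, an even number; complementing therefore turns odd degrees
  -- into even ones.
  have hcard : Even (Fintype.card (Σ i, Option (Fin (m i)))) := by
    rw [Fintype.card_sigma]
    refine Finset.even_sum _ fun i _ => ?_
    rw [Fintype.card_option, Fintype.card_fin]
    exact (hm i).add_one
  have hlt : ∀ v, (starForest m).degree v < Fintype.card (Σ i, Option (Fin (m i))) :=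
    fun v => degree_lt_card_verts v
  refine ⟨⟨?_, ?_, h2.isBlock, h2.ediam_eq_two htop⟩, exists_eulerian_circuit h2.connected ?_⟩
  · obtain ⟨G, _, hf, hs, ⟨ψ⟩⟩ := isSolvableDegreeGraph_compl_starForest m
    exact ⟨G, _, hf, hs, ⟨φ.trans ψ⟩⟩
  · rintro ⟨k, hk⟩
    have h3 := hk (φ.symm c)
    have h4 := hk (φ.symm l)
    have h5 := hlt c
    have h6 := hlt l
    rw [hdeg, φ.apply_symm_apply, degree_starForest_none] at h3
    rw [hdeg, φ.apply_symm_apply, degree_starForest_some] at h4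
    rw [degree_starForest_none] at h5
    rw [degree_starForest_some] at h6
    omega
  · intro v
    have h3 : Odd ((starForest m).degree (φ v)) := by
      rcases φ v with ⟨j, _ | x⟩
      · rw [degree_starForest_none]; exact hm j
      · rw [degree_starForest_some]; exact odd_one
    have h4 := hlt (φ v)
    have h5 := hdeg v
    obtain ⟨a, ha⟩ := hcard
    obtain ⟨b, hb⟩ := h3
    exact ⟨a - b - 1, by omega⟩

end StarForest

/-! ### Counting isomorphism classes -/

/-- Two stars with `2 * a + 1` and `2 * b + 1` leaves and `t` stars with one leaf. -/
def starSizes (a b t : ℕ) : Fin (t + 2) → ℕ :=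
  Fin.cons (2 * a + 1) (Fin.cons (2 * b + 1) fun _ => 1)

theorem exists_graph {n a b t : ℕ} (ha : 1 ≤ a) (hn : n = 2 * (a + b + t + 2)) :
    ∃ Γ : SimpleGraph (Fin n), (Γ ∈ classG n ∧ IsEulerian Γ) ∧
      Nonempty (Γ ≃g (starForest (starSizes a b t))ᶜ) := by
  have hcard : Fintype.card (Fin n) =
      Fintype.card (Σ i, Option (Fin (starSizes a b t i))) := by
    rw [Fintype.card_sigma]
    simp only [Fintype.card_option, Fintype.card_fin]
    simp [starSizes, Fin.sum_univ_succ]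
    omega
  let e := Fintype.equivOfCardEq hcard
  let φ : ((starForest (starSizes a b t))ᶜ.comap e) ≃g (starForest (starSizes a b t))ᶜ :=
    ⟨e, Iff.rfl⟩
  refine ⟨_, mem_classG_and_isEulerian φ (by omega) (fun i => ?_) (i := 0) ?_, ⟨φ⟩⟩
  · refine Fin.cases ?_ (fun i => Fin.cases ?_ (fun i => ?_) i) i <;> simp [starSizes]
  · simp [starSizes]
    omega

/-- The degree sums give `a + b` and `a ^ 2 + b ^ 2`, hence `(a - b) ^ 2`; the order `b ≤ a` fixes
the sign. -/
theorem params_eq_of_iso {a b t a' b' t' : ℕ} (hba : b ≤ a) (hba' : b' ≤ a')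
    (h : a + b + t = a' + b' + t')
    (φ : (starForest (starSizes a b t))ᶜ ≃g (starForest (starSizes a' b' t'))ᶜ) :
    a = a' ∧ b = b' := by
  have h1 := sum_eq_of_iso φ id
  have h2 := sum_eq_of_iso φ (· ^ 2)
  simp only [starSizes, Fin.sum_univ_succ, Fin.cons_zero, Fin.cons_succ, id, Finset.sum_const,
    Finset.card_univ, Fintype.card_fin, smul_eq_mul] at h1 h2
  have h3 : a + b = a' + b' := by omega
  have ht : t = t' := by omega
  have h4 : (a : ℤ) + b = a' + b' := by exact_mod_cast h3
  have h5 : (a : ℤ) ^ 2 + b ^ 2 = a' ^ 2 + b' ^ 2 := by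
    zify at h2
    rw [ht] at h2
    nlinarith
  have h6 : ((a : ℤ) - b) ^ 2 = (a' - b') ^ 2 := by
    linear_combination 2 * h5 - (a + b + a' + b') * h4
  have h7 : (a : ℤ) - b = a' - b' :=
    (sq_eq_sq₀ (by omega) (by omega)).1 h6
  omega

end CharDegree

theorem theorem4p1 (n : ℕ) (hn : 6 ≤ n) (heven : Even n) :
    (n - 4) / 2 + (n / 6 - 1) ≤
      CharDegree.numIsoClasses {Γ ∈ CharDegree.classG n | CharDegree.IsEulerian Γ} := by
  classical
  obtain ⟨k, hk⟩ := heven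
  -- Here `n = 2k`, and `a + b + 2 ≤ k` leaves room for `t = k - 2 - a - b` single edges. The pairs
  -- `(a, 0)` number `(n - 4) / 2`; the pairs `(a, a)` fit since `2a + 2 ≤ 2 (n / 6) ≤ k`, and `a ≥
  -- 1` keeps the families disjoint.
  let P : Finset (ℕ × ℕ) := (Finset.Icc 1 (k - 2)).image (fun a => (a, 0)) ∪
    (Finset.Icc 1 (n / 6 - 1)).image (fun a => (a, a))
  have hP : ∀ q ∈ P, 1 ≤ q.1 ∧ q.2 ≤ q.1 ∧ q.1 + q.2 + 2 ≤ k := by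
    intro q hq
    rcases Finset.mem_union.1 hq with h | h <;> obtain ⟨a, ha, rfl⟩ := Finset.mem_image.1 h <;>
      rw [Finset.mem_Icc] at ha <;> dsimp only <;> omega
  have hcard : P.card = (n - 4) / 2 + (n / 6 - 1) := by
    rw [Finset.card_union_of_disjoint, Finset.card_image_of_injective,
      Finset.card_image_of_injective, Nat.card_Icc, Nat.card_Icc]
    · omega
    · intro a b h
      exact congrArg Prod.fst h
    · intro a b h
      exact congrArg Prod.fst h
    · rw [Finset.disjoint_left]
      intro q h1 h2
      obtain ⟨a, ha, rfl⟩ := Finset.mem_image.1 h1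
      obtain ⟨b, hb, h⟩ := Finset.mem_image.1 h2
      rw [Finset.mem_Icc] at hb
      have h3 : b = 0 := congrArg Prod.snd h
      omega
  have hex : ∀ q : P, ∃ Γ : SimpleGraph (Fin n),
      (Γ ∈ CharDegree.classG n ∧ CharDegree.IsEulerian Γ) ∧ Nonempty (Γ ≃g
        (CharDegree.starForest (CharDegree.starSizes q.1.1 q.1.2 (k - 2 - q.1.1 - q.1.2)))ᶜ) :=
    fun q => CharDegree.exists_graph (hP q q.2).1 (by have := hP q q.2; omega)
  choose Γ hΓ hiso using hex
  have hinj : Function.Injective fun q => Quotient.mk (CharDegree.isoSetoid n) (Γ q) := by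
    intro q q' h
    obtain ⟨φ⟩ : Nonempty (Γ q ≃g Γ q') := Quotient.exact h
    obtain ⟨ψ⟩ := hiso q
    obtain ⟨ψ'⟩ := hiso q'
    have h1 := hP q q.2
    have h2 := hP q' q'.2
    have := CharDegree.params_eq_of_iso h1.2.1 h2.2.1 (by omega) ((ψ.symm.trans φ).trans ψ')
    exact Subtype.ext (Prod.ext this.1 this.2)
  rw [CharDegree.numIsoClasses, ← hcard, ← Fintype.card_coe, ← Nat.card_eq_fintype_card,
    ← Set.ncard_univ, ← Set.ncard_image_of_injective _ hinj]
  refine Set.ncard_le_ncard ?_ (Set.toFinite _)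
  rintro _ ⟨q, -, rfl⟩
  exact ⟨Γ q, hΓ q, rfl⟩
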